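/- Identify $2^{\mathbb N}$ with the set of $0$-$1$ sequences in Baire space $\mathbb N^{\mathbb N}$. A set $P\subseteq 2^{\mathbb N}$ is $\Pi^0_1$ if it is the set $[T]$ of infinite paths of some computable tree $T\subseteq 2^{<\mathbb N}$; it is \emph{special} if it is nonempty and has no computable member. Let $P=[T]$ with such a tree $T$ fixed (written $T_P$), and let $L_P$ be the set of leaves of $T_P$. Put $$P^{\frown}R = P\cup\bigcup_{\rho\in L_P}\rho^{\frown}R,\qquad \textstyle\bigvee P=\bigcup_{n\in\mathbb N}\underbrace{P^{\frown}(P^{\frown}(\cdots{}^{\frown}P))}_{n+1\text{ copies of }P}$$ (the latter is the LCM disjunction of $P,P,\dots$). Let $(\Phi_e)_{e\in\mathbb N}$ be a standard effective enumeration of the Turing functionals on $\mathbb N^{\mathbb N}$. A learner is a computable function $\Psi:\mathbb N^{<\mathbb N}\to\mathbb N$; it identifies a partial function $\Gamma:\subseteq\mathbb N^{\mathbb N}\to\mathbb N^{\mathbb N}$ if for all $g\in\mathrm{dom}(\Gamma)$ the limit $e=\lim_n\Psi(g\restriction n)$ exists and $\Phi_e(g)=\Gamma(g)$. The function $\Gamma$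 is * $(1,\omega)$-computable if it is identified by some learner; * $(1,<\omega)$-computable if it is identified by some learner $\Psi$ for which $\#\{n:\Psi(g\restriction (n+1))\neq\Psi(g\restriction n)\}$ is bounded by a constant for all $g\in\mathrm{dom}(\Gamma)$; * $(<\omega,1)$-computable if there is $b\in\mathbb N$ such that for all $g\in\mathrm{dom}(\Gamma)$ there is $e<b$ with $\Gamma(g)=\Phi_e(g)$. For sets $A,B\subseteq\mathbb N^{\mathbb N}$ write $A\le^\alpha_\beta B$ if some $(\alpha,\beta)$-computable $\Gamma$ is defined on all of $B$ and maps $B$ into $A$; $A<^\alpha_\beta B$ means $A\le^\alpha_\beta B\not\le^\alpha_\beta A$, and $A\equiv^\alpha_\beta B$ means $A\le^\alpha_\beta B\le^\alpha_\beta A$. **Theorem.** 1. Let $P\subseteq 2^{\mathbb N}$ be a nonempty $\Pi^0_1$ set with a computable tree $T_P$ as above. Then for every special $\Pi^0_1$ set $Q\subseteq 2^{\mathbb N}$ there is a $\Pi^0_1$ set $\widehat P\subseteq\bigvee P$ such that $Q\not\le^{1}_{<\omega}\widehat P$ and, moreover, $Q\not\le^{<\omega}_{1}\widehat P$. 2.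 For every special $\Pi^0_1$ set $P\subseteq 2^{\mathbb N}$ and every computable tree $T_P$ as above, $\bigvee P<^{<\omega}_1 P\equiv^1_\omega\bigvee P$. 3. For every special $\Pi^0_1$ set $P\subseteq 2^{\mathbb N}$ there is a $\Pi^0_1$ set $Q\subseteq 2^{\mathbb N}$ with $Q<^{<\omega}_1 P\equiv^1_\omega Q$. -/

import Mathlib

namespace MassProblem

/-! ### Strings, trees and infinite paths -/

/-- The initial segment `f ↾ n = ⟨f 0, …, f (n - 1)⟩`. -/
def restr (f : ℕ → ℕ) (n : ℕ) : List ℕ := (List.range n).map f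

/-- The infinite word `σ ⌢ f`. -/
def prepend (σ : List ℕ) (f : ℕ → ℕ) : ℕ → ℕ :=
  fun n => (σ[n]?).getD (f (n - σ.length))

/-- The set `[T]` of infinite paths of `T`. -/
def paths (T : Set (List ℕ)) : Set (ℕ → ℕ) := {f | ∀ n, restr f n ∈ T}

/-- The set of leaves (dead ends) of `T`. -/
def leaves (T : Set (List ℕ)) : Set (List ℕ) :=
  {σ | σ ∈ T ∧ ∀ τ ∈ T, σ <+: τ → τ = σ}

/-- `T` is a computable subtree of `2^{<ℕ}` whose set of infinite paths is `P`. -/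
structure IsComputableTreeOf (T : Set (List ℕ)) (P : Set (ℕ → ℕ)) : Prop where
  prefix_mem : ∀ σ τ : List ℕ, σ <+: τ → τ ∈ T → σ ∈ T
  binary : ∀ σ ∈ T, ∀ i ∈ σ, i < 2
  computable : ComputablePred (fun σ : List ℕ => σ ∈ T)
  paths_eq : paths T = P

/-- `P` is a `Π⁰₁` subset of Cantor space `2^ℕ ⊆ ℕ^ℕ`. -/
def IsPi01 (P : Set (ℕ → ℕ)) : Prop := ∃ T, IsComputableTreeOf T P

/-- `P` is special: nonempty and without computable members. -/
def IsSpecial (P : Set (ℕ → ℕ)) : Prop := P.Nonempty ∧ ∀ f ∈ P, ¬ Computable f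

/-! ### Concatenation and the LCM disjunction -/

/-- The non-commutative concatenation `P ∪ ⋃ {ρ ⌢ Q : ρ a leaf of T}`, where `P = [T]`. -/
def concat (T : Set (List ℕ)) (Q : Set (ℕ → ℕ)) : Set (ℕ → ℕ) :=
  paths T ∪ ⋃ ρ ∈ leaves T, prepend ρ '' Q

/-- The iterated concatenation of `P₀, …, Pₙ`, in this order, where `Pᵢ = [T i]`. -/
def iterConcat : (ℕ → Set (List ℕ)) → ℕ → Set (ℕ → ℕ)
  | T, 0 => paths (T 0)
  | T, n + 1 => concat (T 0) (iterConcat (fun i => T (i + 1)) n)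

/-- The LCM disjunction of the sequence `Pᵢ = [T i]`. -/
def lcmDisjunction (T : ℕ → Set (List ℕ)) : Set (ℕ → ℕ) := ⋃ n, iterConcat T n

/-- The LCM disjunction of the constant sequence `P, P, …`, where `P = [T]`. -/
def lcmPower (T : Set (List ℕ)) : Set (ℕ → ℕ) := lcmDisjunction (fun _ => T)

/-! ### Turing functionals and learners -/

/-- `Φ e g n` is the value `Φ_e(g; n)` of the `e`-th Turing functional with oracle `g` on input `n`.
The `e`-th program is run, for more and more steps, on the inputs `(g ↾ k, n)`, for all finite parts
`g ↾ k` of the oracle; the first value that is found is the output. (Every Turing functional has this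
form: take a program that on input `(σ, n)` simulates the oracle machine with input `n` for `|σ|`
steps, answering the queries from `σ`, and that diverges if there is no output by then.) -/
def Φ (e : ℕ) (g : ℕ → ℕ) : ℕ →. ℕ := fun n =>
  Nat.rfindOpt fun s =>
    Nat.Partrec.Code.evaln s.unpair.2 (Denumerable.ofNat Nat.Partrec.Code e)
      (Encodable.encode (restr g s.unpair.1, n))

/-- `Φ_e(g) = h`; in particular, `Φ_e(g)` is total. -/
def FunctionalEq (e : ℕ) (g h : ℕ → ℕ) : Prop := ∀ n, h n ∈ Φ e g n

/-- The set of mind-change locations of the learner `Ψ` on `g`. -/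
def mindChanges (Ψ : List ℕ → ℕ) (g : ℕ → ℕ) : Set ℕ :=
  {n | Ψ (restr g (n + 1)) ≠ Ψ (restr g n)}

/-- The learner `Ψ` identifies `Γ`: for each `g` in the domain of `Γ`, the limit `e` of the guesses
`Ψ (g ↾ n)` exists, and `Φ_e(g) = Γ(g)`. -/
def Identifies (Ψ : List ℕ → ℕ) (Γ : (ℕ → ℕ) →. (ℕ → ℕ)) : Prop :=
  ∀ g, ∀ h ∈ Γ g, ∃ e, (∀ᶠ n in Filter.atTop, Ψ (restr g n) = e) ∧ FunctionalEq e g h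

/-! ### Classes of partial functions on Baire space and their reducibilities -/

/-- `Γ` is `(1,<ω)`-computable: identified by a computable learner, with a uniform finite bound on
the number of mind changes. -/
def OneFinComputable (Γ : (ℕ → ℕ) →. (ℕ → ℕ)) : Prop :=
  ∃ Ψ : List ℕ → ℕ, Computable Ψ ∧ Identifies Ψ Γ ∧
    ∃ b : ℕ, ∀ g ∈ Γ.Dom, (mindChanges Ψ g).encard ≤ b

/-- `Γ` is `(1,ω)`-computable: identified by a computable learner. -/
def OneOmegaComputable (Γ : (ℕ → ℕ) →. (ℕ → ℕ)) : Prop :=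
  ∃ Ψ : List ℕ → ℕ, Computable Ψ ∧ Identifies Ψ Γ

/-- `Γ` is `(<ω,1)`-computable: for some `b`, each value `Γ(g)` is `Φ_e(g)` for some `e < b`. -/
def FinOneComputable (Γ : (ℕ → ℕ) →. (ℕ → ℕ)) : Prop :=
  ∃ b : ℕ, ∀ g, ∀ h ∈ Γ g, ∃ e < b, FunctionalEq e g h

/-- `P ≤_𝓕 Q`: some `Γ` in the class `𝓕` is defined on all of `Q` and maps `Q` into `P`. -/
def Reducible (𝓕 : ((ℕ → ℕ) →. (ℕ → ℕ)) → Prop) (P Q : Set (ℕ → ℕ)) : Prop :=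
  ∃ Γ, 𝓕 Γ ∧ ∀ g ∈ Q, ∃ h ∈ Γ g, h ∈ P

/-- `P <_𝓕 Q`. -/
def StrictlyReducible (𝓕 : ((ℕ → ℕ) →. (ℕ → ℕ)) → Prop) (P Q : Set (ℕ → ℕ)) : Prop :=
  Reducible 𝓕 P Q ∧ ¬ Reducible 𝓕 Q P

/-- `P ≡_𝓕 Q`. -/
def Equivalent (𝓕 : ((ℕ → ℕ) →. (ℕ → ℕ)) → Prop) (P Q : Set (ℕ → ℕ)) : Prop :=
  Reducible 𝓕 P Q ∧ Reducible 𝓕 Q P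

end MassProblem

open MassProblem

/-! Everything rests on one set `P'` with `P ⊆ P' ⊆ ⋁P` to which `Q` does not (<ω,1)-reduce
(`exists_between`). If `P` has a computable member, `P' = P` works. Otherwise `P'` is the set of
paths through strings `ρ₀ ⌢ ⋯ ⌢ ρₖ ⌢ τ` with leaves `ρᵢ` and a node `τ` of `T_P`. The leaf `ρ₀` is
free; each later leaf must be the least one after which some `Φ_e`, `e ≤ |ρ₀|`, outputs a node of
`T_Q` as long as the string `σ` built before it.

Leaves cannot be added forever: by pigeonhole one `e` would succeed infinitely often, and since the
forced choices are computable, `Φ_e` would produce a computable member of `Q`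
(`not_forall_nextBlock`). Hence `P' ⊆ ⋁P`. Conversely, given `b`, take `|ρ₀| ≥ b` and extend until
no leaf is admissible, at `σ`. If `Φ_e(σ ⌢ f) ∈ Q` with `f ∈ P` and `e < b`, a finite part of `f`
already yields `|σ|` values; it extends to a leaf, as `P` has no computable member, and that leaf
shows that `σ` could be continued (`exists_path_forall_not_functionalEq`).

A bounded number of mind changes reduces to finitely many functionals by hardwiring the final count
(`Reducible.finOne_of_oneFin`). In the other direction, leaves form a prefix-free code, so a learner
finds in the limit where the final path of `P` begins (`reducible_oneOmega_lcmPower`). -/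

namespace MassProblem

open Nat.Partrec (Code)
open Encodable Denumerable Filter

/-! ### Closure properties of decidable predicates -/

section Computability

variable {α β : Type*} [Primcodable α] [Primcodable β]

open Classical in
theorem computablePred_iff_decide {p : α → Prop} :
    ComputablePred p ↔ Computable fun a => decide (p a) :=
  ⟨fun h => h.decide, fun h => ⟨inferInstance, h⟩⟩

theorem _root_.ComputablePred.comp {p : β → Prop} (hp : ComputablePred p) {f : α → β}
    (hf : Computable f) : ComputablePred fun a => p (f a) := by
  classical
  rw [computablePred_iff_decide] at hp ⊢
  exact hp.comp hf

theorem _root_.ComputablePred.and {p q : α → Prop} (hp : ComputablePred p) (hq : ComputablePred q) :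
    ComputablePred fun a => p a ∧ q a := by
  classical
  rw [computablePred_iff_decide] at hp hq ⊢
  exact (Primrec.and.to_comp.comp hp hq).of_eq fun a => by simp

theorem _root_.ComputablePred.or {p q : α → Prop} (hp : ComputablePred p) (hq : ComputablePred q) :
    ComputablePred fun a => p a ∨ q a := by
  classical
  rw [computablePred_iff_decide] at hp hq ⊢
  exact (Primrec.or.to_comp.comp hp hq).of_eq fun a => by simp

theorem _root_.ComputablePred.exists_lt {p : α → ℕ → Prop}
    (hp : ComputablePred fun x : α × ℕ => p x.1 x.2) {f : α → ℕ} (hf : Computable f) :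
    ComputablePred fun a => ∃ n < f a, p a n := by
  classical
  rw [computablePred_iff_decide] at hp ⊢
  have h := Computable.nat_rec (h := fun (a : α) (x : ℕ × Bool) => x.2 || decide (p a x.1))
    hf (Computable.const false)
    (Primrec.or.to_comp.comp (Computable.snd.comp Computable.snd)
      (hp.comp (Computable.pair Computable.fst (Computable.fst.comp Computable.snd)))).to₂
  refine h.of_eq fun a => ?_
  induction f a with
  | zero => simp
  | succ n ih =>
    simp only [ih, ← Bool.decide_or, decide_eq_decide]
    exact ⟨fun h => h.elim (fun ⟨k, hk, h⟩ => ⟨k, by omega, h⟩) fun h => ⟨n, by omega, h⟩,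
      fun ⟨k, hk, h⟩ => (Nat.lt_succ_iff_lt_or_eq.1 hk).imp (fun hk => ⟨k, hk, h⟩)
        fun hk : k = n => hk ▸ h⟩

theorem _root_.ComputablePred.forall_lt {p : α → ℕ → Prop}
    (hp : ComputablePred fun x : α × ℕ => p x.1 x.2) {f : α → ℕ} (hf : Computable f) :
    ComputablePred fun a => ∀ n < f a, p a n :=
  (ComputablePred.exists_lt (p := fun a n => ¬ p a n) hp.not hf).not.of_eq fun a => by simp

theorem computablePred_eq [DecidableEq β] {f g : α → β} (hf : Computable f) (hg : Computable g) :
    ComputablePred fun a => f a = g a :=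
  ComputablePred.comp (p := fun x : β × β => x.1 = x.2)
    (PrimrecPred.computablePred (Primrec.eq (α := β))) (hf.pair hg)

theorem computablePred_le {f g : α → ℕ} (hf : Computable f) (hg : Computable g) :
    ComputablePred fun a => f a ≤ g a :=
  ComputablePred.comp (p := fun x : ℕ × ℕ => x.1 ≤ x.2)
    (PrimrecPred.computablePred Primrec.nat_le) (hf.pair hg)

end Computability

/-! ### Initial segments -/

@[simp] theorem length_restr (g : ℕ → ℕ) (n : ℕ) : (restr g n).length = n := by simp [restr]

theorem restr_succ (g : ℕ → ℕ) (n : ℕ) : restr g (n + 1) = restr g n ++ [g n] := by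
  simp [restr, List.range_succ]

theorem take_restr (g : ℕ → ℕ) (k n : ℕ) : (restr g n).take k = restr g (min k n) := by
  simp [restr, ← List.map_take, List.take_range]

theorem restr_prefix (g : ℕ → ℕ) {m n : ℕ} (h : m ≤ n) : restr g m <+: restr g n := by
  rw [← min_eq_left h, ← take_restr]
  exact List.take_prefix _ _

theorem eq_restr_of_prefix {g : ℕ → ℕ} {n : ℕ} {σ : List ℕ} (h : σ <+: restr g n) :
    σ = restr g σ.length := by
  have h1 := List.prefix_iff_eq_take.1 h
  have h2 := h.length_le
  rw [take_restr, length_restr] at *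
  rwa [min_eq_left h2] at h1

theorem computable_restr {g : ℕ → ℕ} (hg : Computable g) : Computable (restr g) := by
  have h := Computable.nat_rec (f := fun n : ℕ => n) (g := fun _ => ([] : List ℕ))
    (h := fun _ x => x.2 ++ [g x.1]) Computable.id (Computable.const _)
    (Computable.list_concat.comp (Computable.snd.comp Computable.snd)
      (hg.comp (Computable.fst.comp Computable.snd))).to₂
  refine h.of_eq fun n => ?_
  induction n with
  | zero => rfl
  | succ n ih => rw [restr_succ, ← ih]

theorem prepend_append (σ τ : List ℕ) (f : ℕ → ℕ) :
    prepend (σ ++ τ) f = prepend σ (prepend τ f) := by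
  funext n
  simp only [prepend, List.length_append, List.getElem?_append]
  split_ifs with h
  · simp [h]
  · rw [List.getElem?_eq_none (l := σ) (by omega)]
    simp [Nat.sub_sub]

@[simp] theorem prepend_nil (f : ℕ → ℕ) : prepend [] f = f := by
  funext n; simp [prepend]

theorem restr_prepend_add (σ : List ℕ) (f : ℕ → ℕ) (n : ℕ) :
    restr (prepend σ f) (σ.length + n) = σ ++ restr f n := by
  apply List.ext_getElem
  · simp
  intro i h1 h2
  simp only [restr, List.getElem_map, List.getElem_range, List.getElem_append, prepend]
  split_ifs with h
  · simp [h]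
  · rw [List.getElem?_eq_none (by omega)]
    simp

theorem prepend_restr (g : ℕ → ℕ) (n : ℕ) : prepend (restr g n) (fun i => g (n + i)) = g := by
  funext i
  simp only [prepend, length_restr]
  rcases lt_or_ge i n with h | h
  · simp [restr, h]
  · rw [List.getElem?_eq_none (by simpa using h)]
    simp [h]

/-! ### Turing functionals -/

/-- The first value among `u 0, …, u (n - 1)`. -/
def firstSome {α : Type*} (u : ℕ → Option α) : ℕ → Option α
  | 0 => none
  | n + 1 => (firstSome u n).or (u n)

theorem firstSome_eq_none {α : Type*} {u : ℕ → Option α} {n : ℕ} :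
    firstSome u n = none ↔ ∀ t < n, u t = none := by
  induction n with
  | zero => simp [firstSome]
  | succ n ih => simp only [firstSome, Option.or_eq_none_iff, ih, Nat.forall_lt_succ_right]

theorem firstSome_eq_some {α : Type*} {u : ℕ → Option α} {n : ℕ} {v : α} :
    firstSome u n = some v ↔ ∃ s < n, u s = some v ∧ ∀ t < s, u t = none := by
  induction n with
  | zero => simp [firstSome]
  | succ n ih =>
    simp only [firstSome, Option.or_eq_some_iff, ih, firstSome_eq_none, Nat.exists_lt_succ_right,
      and_comm]

theorem mem_rfindOpt_iff {α : Type*} {u : ℕ → Option α} {v : α} :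
    v ∈ Nat.rfindOpt u ↔ ∃ s, u s = some v ∧ ∀ t < s, u t = none := by
  constructor
  · intro h
    obtain ⟨s, h, hs⟩ := Part.mem_bind_iff.1 h
    exact ⟨s, Part.mem_coe.1 hs, fun t ht => by simpa using (Nat.mem_rfind.1 h).2 ht⟩
  · rintro ⟨s, hs, h⟩
    refine Part.mem_bind_iff.2 ⟨s, Nat.mem_rfind.2 ⟨?_, fun ht => ?_⟩, Part.mem_coe.2 hs⟩
    · simp [hs]
    · simp [h _ ht]

/-- The result, if any, of running the `e`-th functional on input `i` for `|σ|` stages, with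
oracle `σ`. -/
def run (e : ℕ) (σ : List ℕ) (i : ℕ) : Option ℕ :=
  firstSome (fun s => Code.evaln s.unpair.2 (ofNat Code e) (encode (σ.take s.unpair.1, i))) σ.length

theorem primrec_run : Primrec fun x : (ℕ × List ℕ) × ℕ => run x.1.1 x.1.2 x.2 := by
  have hs : Primrec fun p : ((ℕ × List ℕ) × ℕ) × ℕ × Option ℕ => p.2.1.unpair :=
    Primrec.unpair.comp (Primrec.fst.comp Primrec.snd)
  have he : Primrec fun p : ((ℕ × List ℕ) × ℕ) × ℕ × Option ℕ =>
      Code.evaln p.2.1.unpair.2 (ofNat Code p.1.1.1)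
        (encode (p.1.1.2.take p.2.1.unpair.1, p.1.2)) :=
    Code.primrec_evaln.comp <| Primrec.pair
      (Primrec.pair (Primrec.snd.comp hs)
        ((Primrec.ofNat Code).comp (Primrec.fst.comp (Primrec.fst.comp Primrec.fst))))
      (Primrec.encode.comp (Primrec.pair (Primrec.list_take.comp (Primrec.fst.comp hs)
        (Primrec.snd.comp (Primrec.fst.comp Primrec.fst))) (Primrec.snd.comp Primrec.fst)))
  refine (Primrec.nat_rec' (Primrec.list_length.comp (Primrec.snd.comp Primrec.fst))
    (Primrec.const (none : Option ℕ))
    (Primrec.option_orElse.comp (Primrec.snd.comp Primrec.snd) he).to₂).of_eq fun x => ?_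
  rw [run]
  generalize x.1.2.length = n
  induction n with
  | zero => rfl
  | succ n ih => rw [firstSome, ← ih]; simp

/-- Stage `s` reads at most `s` oracle entries, so lengthening the oracle leaves the earlier stages
unchanged. -/
theorem run_mono {e : ℕ} {σ τ : List ℕ} {i v : ℕ} (h : σ <+: τ) (hv : run e σ i = some v) :
    run e τ i = some v := by
  have key : ∀ {s : ℕ}, s < σ.length → τ.take s.unpair.1 = σ.take s.unpair.1 := by
    intro s hs
    obtain ⟨ρ, rfl⟩ := h
    exact List.take_append_of_le_length ((Nat.unpair_left_le s).trans hs.le)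
  simp only [run, firstSome_eq_some] at hv ⊢
  obtain ⟨s, hn, hs, hlt⟩ := hv
  exact ⟨s, hn.trans_le h.length_le, by rwa [key hn],
    fun t ht => by rw [key (ht.trans hn)]; exact hlt t ht⟩

theorem run_restr_inj {e : ℕ} {g : ℕ → ℕ} {i m n v w : ℕ} (hv : run e (restr g m) i = some v)
    (hw : run e (restr g n) i = some w) : v = w :=
  Option.some.inj <|
    (run_mono (restr_prefix g (le_max_left m n)) hv).symm.trans
      (run_mono (restr_prefix g (le_max_right m n)) hw)

theorem mem_Φ_iff {e : ℕ} {g : ℕ → ℕ} {i v : ℕ} :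
    v ∈ Φ e g i ↔ ∃ n, run e (restr g n) i = some v := by
  have key : ∀ {n s : ℕ}, s < n → (restr g n).take s.unpair.1 = restr g s.unpair.1 := by
    intro n s h
    rw [take_restr, min_eq_left ((Nat.unpair_left_le s).trans h.le)]
  simp only [Φ, mem_rfindOpt_iff, run, firstSome_eq_some, length_restr]
  constructor
  · rintro ⟨s, hs, h⟩
    refine ⟨s + 1, s, s.lt_succ_self, ?_, fun t ht => ?_⟩
    · rwa [key s.lt_succ_self]
    · rw [key (ht.trans s.lt_succ_self)]
      exact h t ht
  · rintro ⟨n, s, hn, hs, h⟩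
    refine ⟨s, by rwa [key hn] at hs, fun t ht => ?_⟩
    rw [← h t ht, key (ht.trans hn)]

/-- Parametrized Turing functionals, given by a computable and consistent family of approximations. -/
theorem exists_functional {F : ℕ → List ℕ → ℕ → Option ℕ}
    (hF : Computable fun x : ℕ × List ℕ × ℕ => F x.1 x.2.1 x.2.2) :
    ∃ d : ℕ → ℕ, Computable d ∧ ∀ a g h,
      (∀ n, ∃ k, F a (restr g k) n = some (h n)) →
      (∀ n k w, F a (restr g k) n = some w → w = h n) → FunctionalEq (d a) g h := by
  have hp : Computable fun x : ℕ => F x.unpair.1 (ofNat (List ℕ × ℕ) x.unpair.2).1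
      (ofNat (List ℕ × ℕ) x.unpair.2).2 := by
    have h2 : Computable fun x : ℕ => ofNat (List ℕ × ℕ) x.unpair.2 :=
      (Computable.ofNat _).comp (Computable.snd.comp Computable.unpair)
    exact hF.comp ((Computable.fst.comp Computable.unpair).pair h2)
  obtain ⟨c, hc⟩ := Code.exists_code.1 (Partrec.nat_iff.1 hp.ofOption)
  have hev : ∀ a σ n v, v ∈ Code.eval (Code.curry c a) (encode ((σ, n) : List ℕ × ℕ)) ↔
      F a σ n = some v := by
    intro a σ n v
    rw [Code.eval_curry, hc]
    simp
  refine ⟨fun a => encode (Code.curry c a),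
    (Primrec.encode.comp (Code.primrec₂_curry.comp (Primrec.const c) Primrec.id)).to_comp,
    fun a g h h1 h2 n => ?_⟩
  have hdom : (Φ (encode (Code.curry c a)) g n).Dom := by
    obtain ⟨k, hk⟩ := h1 n
    obtain ⟨t, ht⟩ := Code.evaln_complete.1 ((hev _ _ _ _).2 hk)
    exact Nat.rfindOpt_dom.2 ⟨Nat.pair k t, h n, by simpa using ht⟩
  -- By consistency it does not matter which stage of the search succeeds first.
  obtain ⟨s, hs⟩ := Nat.rfindOpt_spec (Part.get_mem hdom)
  have := h2 n _ _ ((hev _ _ _ _).1 (by simpa using Code.evaln_sound hs))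
  rw [← this]
  exact Part.get_mem hdom

/-! ### Leaves of trees -/

section Trees

variable {T : Set (List ℕ)} {P : Set (ℕ → ℕ)}

theorem IsComputableTreeOf.nil_mem (hT : IsComputableTreeOf T P) (hP : P.Nonempty) : [] ∈ T := by
  obtain ⟨f, hf⟩ := hP
  rw [← hT.paths_eq] at hf
  exact hf 0

theorem IsComputableTreeOf.ne_nil_of_mem_leaves (hT : IsComputableTreeOf T P) (hP : P.Nonempty)
    {ρ : List ℕ} (hρ : ρ ∈ leaves T) : ρ ≠ [] := by
  rintro rfl
  obtain ⟨f, hf⟩ := hP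
  rw [← hT.paths_eq] at hf
  simpa using congrArg List.length (hρ.2 _ (hf 1) List.nil_prefix)

theorem IsComputableTreeOf.mem_leaves_iff (hT : IsComputableTreeOf T P) {σ : List ℕ} :
    σ ∈ leaves T ↔ σ ∈ T ∧ σ ++ [0] ∉ T ∧ σ ++ [1] ∉ T := by
  constructor
  · rintro ⟨h, hmax⟩
    refine ⟨h, fun h0 => ?_, fun h1 => ?_⟩
    · simpa using hmax _ h0 (List.prefix_append _ _)
    · simpa using hmax _ h1 (List.prefix_append _ _)
  · rintro ⟨h, h0, h1⟩
    refine ⟨h, fun τ hτ => ?_⟩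
    rintro ⟨ρ, rfl⟩
    cases ρ with
    | nil => simp
    | cons x ρ =>
      have hx : x < 2 := hT.binary _ hτ x (by simp)
      have : σ ++ [x] ∈ T := hT.prefix_mem _ _ ⟨ρ, by simp⟩ hτ
      interval_cases x <;> contradiction

theorem IsComputableTreeOf.computablePred_leaves (hT : IsComputableTreeOf T P) :
    ComputablePred fun σ : List ℕ => σ ∈ leaves T := by
  have h : ∀ i : ℕ, ComputablePred fun σ : List ℕ => σ ++ [i] ∉ T := fun i =>
    (ComputablePred.comp hT.computable
      (Computable.list_concat.comp Computable.id (Computable.const i))).not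
  exact (ComputablePred.and hT.computable ((h 0).and (h 1))).of_eq fun σ => hT.mem_leaves_iff.symm

theorem eq_of_mem_leaves_of_prefix {ρ ρ' η : List ℕ} (hρ : ρ ∈ leaves T) (hρ' : ρ' ∈ leaves T)
    (h : ρ <+: η) (h' : ρ' <+: η) : ρ = ρ' :=
  (List.prefix_or_prefix_of_prefix h h').elim (fun h => (hρ.2 _ hρ'.1 h).symm)
    (fun h => hρ'.2 _ hρ.1 h)

/-- In a tree without computable paths, every initial segment of a path extends to a leaf. -/
theorem IsComputableTreeOf.exists_leaf (hT : IsComputableTreeOf T P)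
    (hP : ∀ f ∈ P, ¬ Computable f) {τ : List ℕ} (hτ : τ ∈ T) : ∃ ρ ∈ leaves T, τ <+: ρ := by
  classical
  by_contra! H
  have hdec := computablePred_iff_decide.1 hT.computable
  -- Without leaves above `τ` every node there has a child, so going left whenever possible traces a
  -- computable path.
  let step : List ℕ → List ℕ := fun σ => bif decide (σ ++ [0] ∈ T) then σ ++ [0] else σ ++ [1]
  have hstep : Computable step := by
    have h : ∀ i : ℕ, Computable fun σ : List ℕ => σ ++ [i] := fun i =>
      Computable.list_concat.comp Computable.id (Computable.const i)
    exact Computable.cond (hdec.comp (h 0)) (h 0) (h 1)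
  let σ : ℕ → List ℕ := fun n => n.rec τ fun _ σ => step σ
  have hσ : Computable σ :=
    Computable.nat_rec Computable.id (Computable.const τ)
      (hstep.comp (Computable.snd.comp Computable.snd)).to₂
  have hsucc : ∀ n, ∃ i, σ (n + 1) = σ n ++ [i] := by
    intro n
    change ∃ i, step (σ n) = _
    simp only [step]
    cases decide (σ n ++ [0] ∈ T)
    · exact ⟨1, rfl⟩
    · exact ⟨0, rfl⟩
  have hmono : ∀ m n, m ≤ n → σ m <+: σ n := by
    intro m n hmn
    induction hmn with
    | refl => exact List.prefix_refl _
    | step _ ih =>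
      obtain ⟨i, hi⟩ := hsucc _
      exact ih.trans (hi ▸ List.prefix_append _ _)
  have hlen : ∀ n, (σ n).length = τ.length + n := by
    intro n
    induction n with
    | zero => rfl
    | succ n ih =>
      obtain ⟨i, hi⟩ := hsucc n
      simp [hi, ih, add_assoc]
  have hmem : ∀ n, σ n ∈ T := by
    intro n
    induction n with
    | zero => exact hτ
    | succ n ih =>
      have h1 : σ n ∉ leaves T := fun h => H _ h (hmono 0 n (Nat.zero_le n))
      rw [hT.mem_leaves_iff] at h1
      change step (σ n) ∈ T
      by_cases h0 : σ n ++ [0] ∈ T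
      · simp [step, h0]
      · simpa [step, h0, ih] using h1
  let g : ℕ → ℕ := fun n => ((σ (n + 1))[n]?).getD 0
  have hg : Computable g :=
    Computable.option_getD (Computable.list_getElem?.comp (hσ.comp Computable.succ) Computable.id)
      (Computable.const 0)
  have hgσ : ∀ n, restr g n = (σ n).take n := by
    intro n
    refine List.ext_getElem (by simp [hlen]) fun i h1 h2 => ?_
    have h1' : i < n := by simpa using h1
    have h3 : i < (σ (i + 1)).length := (hlen (i + 1)).symm ▸ (by omega)
    simp only [restr, List.getElem_map, List.getElem_range, List.getElem_take, g]
    rw [List.getElem?_eq_getElem h3, Option.getD_some]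
    exact (hmono (i + 1) n h1').getElem h3
  refine hP g ?_ hg
  rw [← hT.paths_eq]
  intro n
  rw [hgσ]
  exact hT.prefix_mem _ _ (List.take_prefix _ _) (hmem n)

end Trees

/-! ### Sequences of blocks -/

/-- Each block of `L` is related by `R` to the concatenation of the preceding ones. -/
def IsBlockSeq (R : List ℕ → List ℕ → Prop) (L : List (List ℕ)) : Prop :=
  ∀ M ρ, M ++ [ρ] <+: L → R M.flatten ρ

theorem IsBlockSeq.nil (R : List ℕ → List ℕ → Prop) : IsBlockSeq R [] := by
  intro M ρ h
  simp at h

theorem isBlockSeq_concat {R : List ℕ → List ℕ → Prop} {L : List (List ℕ)} {ρ : List ℕ} :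
    IsBlockSeq R (L ++ [ρ]) ↔ IsBlockSeq R L ∧ R L.flatten ρ := by
  constructor
  · exact fun h => ⟨fun M τ hM => h M τ (hM.trans (List.prefix_append _ _)),
      h L ρ (List.prefix_refl _)⟩
  · rintro ⟨h, hρ⟩ M τ hM
    rcases List.prefix_concat_iff.1 hM with h1 | h1
    · obtain ⟨rfl, h2⟩ := List.append_inj' h1 rfl
      obtain rfl : τ = ρ := by simpa using h2
      exact hρ
    · exact h M τ h1

theorem IsBlockSeq.forall_mem {R : List ℕ → List ℕ → Prop} {S : Set (List ℕ)}
    (hR : ∀ σ τ, R σ τ → τ ∈ S) {L : List (List ℕ)} (hL : IsBlockSeq R L) : ∀ ρ ∈ L, ρ ∈ S := by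
  intro ρ hρ
  obtain ⟨M, N, rfl⟩ := List.append_of_mem hρ
  exact hR _ _ (hL M ρ ⟨N, by simp⟩)

theorem isBlockSeq_of_forall_mem {S : Set (List ℕ)} {L : List (List ℕ)}
    (h : ∀ ρ ∈ L, ρ ∈ S) : IsBlockSeq (fun _ ρ => ρ ∈ S) L :=
  fun _ ρ hM => h ρ (hM.subset (by simp))

/-- `σ` is the concatenation of a sequence of blocks. -/
def IsBlockString (R : List ℕ → List ℕ → Prop) (σ : List ℕ) : Prop :=
  ∃ L, IsBlockSeq R L ∧ L.flatten = σ

/-- Splitting off the last block, which is nonempty, gives a course-of-values recursion on length.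
-/
theorem isBlockString_take {R : List ℕ → List ℕ → Prop} (hR : ∀ σ τ, R σ τ → τ ≠ [])
    (σ : List ℕ) (n : ℕ) :
    IsBlockString R (σ.take n) ↔ σ.take n = [] ∨
      ∃ k < n, IsBlockString R (σ.take k) ∧ R (σ.take k) ((σ.take n).drop k) := by
  constructor
  · rintro ⟨L, hL, h⟩
    rcases List.eq_nil_or_concat L with rfl | ⟨M, ρ, rfl⟩
    · exact Or.inl (by simpa using h.symm)
    · right
      rw [List.concat_eq_append, isBlockSeq_concat] at *
      have hρ := hR _ _ hL.2
      have hpos := List.length_pos_iff.2 hρ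
      have hlen : M.flatten.length + ρ.length ≤ n := by
        have := congrArg List.length h
        simp only [List.flatten_concat, List.length_append, List.length_take] at this
        omega
      have h1 : σ.take M.flatten.length = M.flatten := by
        have := congrArg (List.take M.flatten.length) h
        rw [List.take_take, min_eq_left (by omega)] at this
        simpa using this.symm
      refine ⟨M.flatten.length, by omega, ⟨M, hL.1, h1.symm⟩, ?_⟩
      rw [h1, ← h]
      simpa using hL.2
  · rintro (h | ⟨k, hk, ⟨L, hL, h⟩, hρ⟩)
    · exact ⟨[], IsBlockSeq.nil R, by simp [h]⟩
    · refine ⟨L ++ [(σ.take n).drop k], isBlockSeq_concat.2 ⟨hL, h ▸ hρ⟩, ?_⟩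
      have h2 : σ.take k = (σ.take n).take k := by rw [List.take_take, min_eq_left hk.le]
      rw [List.flatten_concat, h, h2, List.take_append_drop]

theorem computablePred_isBlockString {R : List ℕ → List ℕ → Prop} (hR : ∀ σ τ, R σ τ → τ ≠ [])
    (hc : ComputablePred fun x : List ℕ × List ℕ => R x.1 x.2) :
    ComputablePred fun σ => IsBlockString R σ := by
  classical
  have htake : Computable₂ fun (n : ℕ) (σ : List ℕ) => σ.take n := Primrec.list_take.to_comp
  have hdrop : Computable₂ fun (n : ℕ) (σ : List ℕ) => σ.drop n := Primrec.list_drop.to_comp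
  have hg : ComputablePred fun x : List ℕ × List Bool => x.1.take x.2.length = [] ∨
      ∃ k < x.2.length, x.2[k]? = some true ∧
        R (x.1.take k) ((x.1.take x.2.length).drop k) := by
    have hlen : Computable fun x : List ℕ × List Bool => x.2.length :=
      Computable.list_length.comp Computable.snd
    refine (computablePred_eq (htake.comp hlen Computable.fst) (Computable.const [])).or
      (ComputablePred.exists_lt (ComputablePred.and ?_ ?_) hlen)
    · exact computablePred_eq (Computable.list_getElem?.comp
        (Computable.snd.comp Computable.fst) Computable.snd) (Computable.const (some true))
    · exact hc.comp ((htake.comp Computable.snd (Computable.fst.comp Computable.fst)).pair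
        (hdrop.comp Computable.snd
          (htake.comp (hlen.comp Computable.fst) (Computable.fst.comp Computable.fst))))
  have h := Computable.nat_strong_rec (fun σ n => decide (IsBlockString R (σ.take n)))
    (Computable.option_some.comp (computablePred_iff_decide.1 hg)).to₂ (fun σ n => by
      simp only [List.length_map, List.length_range, Option.some_inj, decide_eq_decide]
      rw [isBlockString_take hR σ n]
      refine or_congr_right (exists_congr fun k => and_congr_right fun hk => ?_)
      simp [hk])
  rw [computablePred_iff_decide]
  exact (h.comp Computable.id Computable.list_length).of_eq fun σ => by simp

/-! ### Unique parsing into leaves, and block trees -/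

section Blocks

variable {T : Set (List ℕ)}

/-- Leaves are pairwise incomparable, so two parses of one string agree block by block until one
stops. -/
theorem prefix_or_prefix_of_flatten {L L' : List (List ℕ)} {η : List ℕ}
    (hL : ∀ ρ ∈ L, ρ ∈ leaves T) (hL' : ∀ ρ ∈ L', ρ ∈ leaves T)
    (h : L.flatten <+: η) (h' : L'.flatten <+: η) : L <+: L' ∨ L' <+: L := by
  induction L generalizing L' η with
  | nil => exact Or.inl List.nil_prefix
  | cons ρ L ih =>
    cases L' with
    | nil => exact Or.inr List.nil_prefix
    | cons ρ' L' =>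
      simp only [List.flatten_cons] at h h'
      obtain rfl := eq_of_mem_leaves_of_prefix (hL ρ (by simp)) (hL' ρ' (by simp))
        ((List.prefix_append _ _).trans h) ((List.prefix_append _ _).trans h')
      obtain ⟨η, rfl⟩ := (List.prefix_append _ _).trans h
      rw [List.prefix_append_right_inj] at h h'
      simpa using ih (fun ρ hρ => hL ρ (by simp [hρ])) (fun ρ hρ => hL' ρ (by simp [hρ])) h h'

/-- A further block of `L'` would be a leaf below `τ ∈ T`, hence `τ` itself, leaving nothing for
`τ'`. -/
theorem eq_of_prefix_of_flatten_append_eq {L L' : List (List ℕ)} {τ τ' : List ℕ}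
    (hL' : ∀ ρ ∈ L', ρ ∈ leaves T) (hτ : τ ∈ T) (hτ' : τ' ≠ [])
    (h : L.flatten ++ τ = L'.flatten ++ τ') (hLL' : L <+: L') : L = L' := by
  obtain ⟨M, rfl⟩ := hLL'
  cases M with
  | nil => simp
  | cons ρ M =>
    simp only [List.flatten_append, List.flatten_cons, List.append_assoc,
      List.append_cancel_left_eq] at h
    have := (hL' ρ (by simp)).2 τ hτ ⟨_, h.symm⟩
    have hlen := congrArg List.length h
    rw [this, List.length_append, List.length_append] at hlen
    exact absurd (List.length_eq_zero_iff.1 (by omega)) hτ'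

theorem eq_of_flatten_append_eq {L L' : List (List ℕ)} {τ τ' : List ℕ}
    (hL : ∀ ρ ∈ L, ρ ∈ leaves T) (hL' : ∀ ρ ∈ L', ρ ∈ leaves T) (hτ : τ ∈ T) (hτ' : τ' ∈ T)
    (hne : τ ≠ []) (hne' : τ' ≠ []) (h : L.flatten ++ τ = L'.flatten ++ τ') : L = L' := by
  rcases prefix_or_prefix_of_flatten hL hL' (List.prefix_append _ τ) ⟨τ', h.symm⟩ with h1 | h1
  · exact eq_of_prefix_of_flatten_append_eq hL' hτ hne' h h1
  · exact (eq_of_prefix_of_flatten_append_eq hL hτ' hne h.symm h1).symm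

theorem exists_of_mem_iterConcat {n : ℕ} {g : ℕ → ℕ} (hg : g ∈ iterConcat (fun _ => T) n) :
    ∃ L : List (List ℕ), (∀ ρ ∈ L, ρ ∈ leaves T) ∧ ∃ f ∈ paths T, g = prepend L.flatten f := by
  induction n generalizing g with
  | zero => exact ⟨[], by simp, g, hg, by simp⟩
  | succ n ih =>
    rcases hg with hg | hg
    · exact ⟨[], by simp, g, hg, by simp⟩
    · simp only [Set.mem_iUnion] at hg
      obtain ⟨ρ, hρ, g', hg', rfl⟩ := hg
      obtain ⟨L, hL, f, hf, rfl⟩ := ih hg'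
      exact ⟨ρ :: L, by simpa [hρ] using hL, f, hf, by simp [prepend_append]⟩

theorem prepend_mem_iterConcat {L : List (List ℕ)} (hL : ∀ ρ ∈ L, ρ ∈ leaves T) {f : ℕ → ℕ}
    (hf : f ∈ paths T) : prepend L.flatten f ∈ iterConcat (fun _ => T) L.length := by
  induction L with
  | nil => simpa [iterConcat] using hf
  | cons ρ L ih =>
    refine Or.inr ?_
    simp only [Set.mem_iUnion]
    exact ⟨ρ, hL ρ (by simp), _, ih fun ρ hρ => hL ρ (by simp [hρ]), by simp [prepend_append]⟩

theorem mem_lcmPower_iff {g : ℕ → ℕ} : g ∈ lcmPower T ↔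
    ∃ L : List (List ℕ), (∀ ρ ∈ L, ρ ∈ leaves T) ∧ ∃ f ∈ paths T, g = prepend L.flatten f := by
  constructor
  · intro hg
    obtain ⟨n, hn⟩ := Set.mem_iUnion.1 hg
    exact exists_of_mem_iterConcat hn
  · rintro ⟨L, hL, f, hf, rfl⟩
    exact Set.mem_iUnion.2 ⟨_, prepend_mem_iterConcat hL hf⟩

/-- The tree of the concatenations of a sequence of blocks and a node of `T`. -/
def blockTree (T : Set (List ℕ)) (R : List ℕ → List ℕ → Prop) : Set (List ℕ) :=
  {η | ∃ L τ, IsBlockSeq R L ∧ τ ∈ T ∧ η = L.flatten ++ τ}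

variable {P : Set (ℕ → ℕ)} {R : List ℕ → List ℕ → Prop}

/-- A prefix that ends inside a block counts that partial block as the final node, since leaves and
their prefixes lie in `T`. -/
theorem IsComputableTreeOf.mem_blockTree_of_prefix (hT : IsComputableTreeOf T P)
    (hR : ∀ σ τ, R σ τ → τ ∈ leaves T) {L : List (List ℕ)} (hL : IsBlockSeq R L) :
    ∀ {τ η : List ℕ}, τ ∈ T → η <+: L.flatten ++ τ → η ∈ blockTree T R := by
  induction L using List.reverseRecOn with
  | nil => exact fun hτ h => ⟨[], _, hL, hT.prefix_mem _ _ h hτ, rfl⟩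
  | append_singleton L ρ ih =>
    intro τ η hτ h
    have hρ : ρ ∈ T := (hR _ _ (isBlockSeq_concat.1 hL).2).1
    rcases List.prefix_or_prefix_of_prefix h (List.prefix_append _ _) with h1 | ⟨τ', rfl⟩
    · exact ih (isBlockSeq_concat.1 hL).1 hρ (by simpa using h1)
    · rw [List.prefix_append_right_inj] at h
      exact ⟨_, τ', hL, hT.prefix_mem _ _ h hτ, rfl⟩

theorem IsComputableTreeOf.blockTree (hT : IsComputableTreeOf T P) (hP : P.Nonempty)
    (hR : ∀ σ τ, R σ τ → τ ∈ leaves T)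
    (hc : ComputablePred fun x : List ℕ × List ℕ => R x.1 x.2) :
    IsComputableTreeOf (blockTree T R) (paths (blockTree T R)) where
  prefix_mem := by
    rintro η _ h ⟨L, τ, hL, hτ, rfl⟩
    exact hT.mem_blockTree_of_prefix hR hL hτ h
  binary := by
    rintro _ ⟨L, τ, hL, hτ, rfl⟩ i hi
    rcases List.mem_append.1 hi with hi | hi
    · obtain ⟨ρ, hρ, hi⟩ := List.mem_flatten.1 hi
      exact hT.binary ρ (hL.forall_mem hR ρ hρ).1 i hi
    · exact hT.binary τ hτ i hi
  computable := by
    have h1 := computablePred_isBlockString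
      (fun σ τ h => hT.ne_nil_of_mem_leaves hP (hR σ τ h)) hc
    refine ComputablePred.of_eq (ComputablePred.exists_lt
      (p := fun η k => IsBlockString R (η.take k) ∧ η.drop k ∈ T) (ComputablePred.and
        (h1.comp (Primrec.list_take.to_comp.comp Computable.snd Computable.fst))
        (hT.computable.comp (Primrec.list_drop.to_comp.comp Computable.snd Computable.fst)))
      (Computable.succ.comp Computable.list_length)) fun η => ?_
    constructor
    · rintro ⟨k, -, ⟨L, hL, h⟩, hk⟩
      exact ⟨L, _, hL, hk, by rw [h, List.take_append_drop]⟩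
    · rintro ⟨L, τ, hL, hτ, rfl⟩
      exact ⟨L.flatten.length, by simp, ⟨L, hL, by simp⟩, by simpa using hτ⟩
  paths_eq := rfl

theorem IsComputableTreeOf.prepend_mem_paths_blockTree (hT : IsComputableTreeOf T P)
    (hR : ∀ σ τ, R σ τ → τ ∈ leaves T) {L : List (List ℕ)} (hL : IsBlockSeq R L)
    {f : ℕ → ℕ} (hf : f ∈ paths T) : prepend L.flatten f ∈ paths (MassProblem.blockTree T R) :=
  fun n => hT.mem_blockTree_of_prefix hR hL (hf n) (by
    rw [← restr_prepend_add]
    exact restr_prefix _ (Nat.le_add_left _ _))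

/-- If a path of the block tree does not consist of finitely many blocks and a path of `T`, then each
block sequence along it can be continued along it. -/
theorem exists_block_of_mem_paths_blockTree (hnil : [] ∈ T) (hR : ∀ σ τ, R σ τ → τ ∈ leaves T)
    {g : ℕ → ℕ} (hg : g ∈ paths (blockTree T R)) (h : ∀ L, IsBlockSeq R L → ∀ f ∈ paths T,
      g ≠ prepend L.flatten f) {L : List (List ℕ)} (hL : IsBlockSeq R L)
    (hLg : L.flatten = restr g L.flatten.length) :
    ∃ ρ, R L.flatten ρ ∧ (L ++ [ρ]).flatten = restr g (L ++ [ρ]).flatten.length := by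
  have h1 : (fun i => g (L.flatten.length + i)) ∉ paths T := fun hf =>
    h L hL _ hf (by rw [hLg]; simpa using (prepend_restr g L.flatten.length).symm)
  simp only [paths, Set.mem_ofPred_eq, not_forall] at h1
  obtain ⟨n, hn⟩ := h1
  have h2 : restr g (L.flatten.length + n) =
      L.flatten ++ restr (fun i => g (L.flatten.length + i)) n := by
    rw [← restr_prepend_add]
    congr 1
    conv_rhs => rw [hLg]
    simpa using (prepend_restr g L.flatten.length).symm
  obtain ⟨L', τ, hL', hτ, h3⟩ := hg (L.flatten.length + n)
  have hl := hL.forall_mem hR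
  have hl' := hL'.forall_mem hR
  -- The remainder after `L` is outside `T`, so the parse `L'`, whose remainder is in `T`, must go
  -- beyond `L`.
  have hLL' : L <+: L' := by
    rcases prefix_or_prefix_of_flatten hl hl' ⟨_, h2.symm⟩ ⟨_, h3.symm⟩ with h4 | h4
    · exact h4
    · exact (eq_of_prefix_of_flatten_append_eq hl hτ (fun h0 => hn (by rwa [h0])) (h3 ▸ h2) h4) ▸
        List.prefix_refl _
  obtain ⟨M, rfl⟩ := hLL'
  cases M with
  | nil =>
    rw [h2] at h3
    simp only [List.append_nil, List.append_cancel_left_eq] at h3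
    exact absurd (h3 ▸ hτ) hn
  | cons ρ M =>
    refine ⟨ρ, hL' L ρ ⟨M, by simp⟩, eq_restr_of_prefix (n := L.flatten.length + n) ?_⟩
    rw [h3]
    simp

end Blocks

/-! ### Convergence of Turing functionals -/

theorem computable_run {α : Type*} [Primcodable α] {e i : α → ℕ} {σ : α → List ℕ}
    (he : Computable e) (hσ : Computable σ) (hi : Computable i) :
    Computable fun a => run (e a) (σ a) (i a) :=
  Computable.comp (f := fun x : (ℕ × List ℕ) × ℕ => run x.1.1 x.1.2 x.2)
    (g := fun a => ((e a, σ a), i a)) primrec_run.to_comp ((he.pair hσ).pair hi)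

theorem FunctionalEq.eventually_run {e : ℕ} {g h : ℕ → ℕ} (H : FunctionalEq e g h) (i : ℕ) :
    ∀ᶠ n in atTop, run e (restr g n) i = some (h i) := by
  obtain ⟨n, hn⟩ := mem_Φ_iff.1 (H i)
  exact eventually_atTop.2 ⟨n, fun m hm => run_mono (restr_prefix g hm) hn⟩

theorem FunctionalEq.exists_run {e : ℕ} {g h : ℕ → ℕ} (H : FunctionalEq e g h) (k : ℕ) :
    ∃ n, ∀ i < k, run e (restr g n) i = some (h i) := by
  have := (eventually_all_finset (Finset.range k)).2 fun i _ => H.eventually_run i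
  simpa using this.exists

theorem FunctionalEq.eq_of_run {e : ℕ} {g h : ℕ → ℕ} (H : FunctionalEq e g h) {i n v : ℕ}
    (hv : run e (restr g n) i = some v) : v = h i := by
  obtain ⟨m, hm⟩ := mem_Φ_iff.1 (H i)
  exact run_restr_inj hv hm

theorem FunctionalEq.computable {e : ℕ} {g h : ℕ → ℕ} (H : FunctionalEq e g h)
    (hg : Computable g) : Computable h := by
  have hc : Computable₂ fun i n => run e (restr g n) i :=
    computable_run (Computable.const e) ((computable_restr hg).comp Computable.snd) Computable.fst
  refine (Partrec.rfindOpt hc).of_eq_tot fun i => ?_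
  refine (Nat.rfindOpt_mono fun hmn h => run_mono (restr_prefix g hmn) h).2 ?_
  exact mem_Φ_iff.1 (H i)

/-! ### The extension strategy -/

/-- The values at `0, …, n - 1` of the `e`-th functional with oracle `σ`, where defined. -/
def output (e : ℕ) (σ : List ℕ) (n : ℕ) : List ℕ :=
  (List.range n).map fun i => (run e σ i).getD 0

theorem computable_output {α : Type*} [Primcodable α] {e n : α → ℕ} {σ : α → List ℕ}
    (he : Computable e) (hσ : Computable σ) (hn : Computable n) :
    Computable fun a => output (e a) (σ a) (n a) := by
  have h : Primrec fun x : (ℕ × List ℕ) × ℕ => output x.1.1 x.1.2 x.2 :=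
    Primrec.list_map (Primrec.list_range.comp Primrec.snd) (Primrec.option_getD.comp
      (primrec_run.comp (Primrec.pair (Primrec.fst.comp Primrec.fst) Primrec.snd))
      (Primrec.const 0)).to₂
  exact Computable.comp (f := fun x : (ℕ × List ℕ) × ℕ => output x.1.1 x.1.2 x.2)
    (g := fun a => ((e a, σ a), n a)) h.to_comp ((he.pair hσ).pair hn)

theorem output_eq_restr {e : ℕ} {σ : List ℕ} {n : ℕ} {h : ℕ → ℕ}
    (H : ∀ i < n, run e σ i = some (h i)) : output e σ n = restr h n :=
  List.map_congr_left fun i hi => by rw [H i (by simpa using hi)]; rfl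

/-- With the leaf `ρ` of `T` appended to `σ`, some functional whose index is bounded by the length
of the first block of `σ` yields a node of `S` of length `|σ|`. -/
def Progress (T S : Set (List ℕ)) (σ ρ : List ℕ) : Prop :=
  ρ ∈ leaves T ∧ ∃ e < σ.length + 1, σ.take e ∈ T ∧
    (∀ i < σ.length, (run e (σ ++ ρ) i).isSome = true) ∧ output e (σ ++ ρ) σ.length ∈ S

/-- The leaf `ρ` of `T` is admissible as the next block after `σ`: the first block is arbitrary, and
each further one is the first leaf that makes progress. -/
def NextBlock (T S : Set (List ℕ)) (σ ρ : List ℕ) : Prop :=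
  ρ ∈ leaves T ∧ (σ = [] ∨ Progress T S σ ρ ∧ ∀ m < encode ρ, ¬ Progress T S σ (ofNat (List ℕ) m))

section

variable {T S : Set (List ℕ)} {P Q : Set (ℕ → ℕ)}

theorem computablePred_progress (hT : IsComputableTreeOf T P) (hS : IsComputableTreeOf S Q) :
    ComputablePred fun x : List ℕ × List ℕ => Progress T S x.1 x.2 := by
  have hlen : Computable fun x : List ℕ × List ℕ => x.1.length :=
    Computable.list_length.comp Computable.fst
  have happ : Computable fun x : (List ℕ × List ℕ) × ℕ => x.1.1 ++ x.1.2 :=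
    Computable.list_append.comp (Computable.fst.comp Computable.fst)
      (Computable.snd.comp Computable.fst)
  have hlen' : Computable fun x : (List ℕ × List ℕ) × ℕ => x.1.1.length :=
    hlen.comp Computable.fst
  have h1 : ComputablePred fun x : (List ℕ × List ℕ) × ℕ => x.1.1.take x.2 ∈ T :=
    hT.computable.comp (Primrec.list_take.to_comp.comp Computable.snd
      (Computable.fst.comp Computable.fst))
  have h2 : ComputablePred fun x : (List ℕ × List ℕ) × ℕ =>
      ∀ i < x.1.1.length, (run x.2 (x.1.1 ++ x.1.2) i).isSome = true := by
    refine ComputablePred.forall_lt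
      (p := fun (x : (List ℕ × List ℕ) × ℕ) i => (run x.2 (x.1.1 ++ x.1.2) i).isSome = true) ?_ hlen'
    have h : Computable fun x : ((List ℕ × List ℕ) × ℕ) × ℕ => run x.1.2 (x.1.1.1 ++ x.1.1.2) x.2 :=
      computable_run (Computable.snd.comp Computable.fst)
        (happ.comp Computable.fst) Computable.snd
    exact computablePred_eq (Primrec.option_isSome.to_comp.comp h) (Computable.const true)
  have h3 : ComputablePred fun x : (List ℕ × List ℕ) × ℕ =>
      output x.2 (x.1.1 ++ x.1.2) x.1.1.length ∈ S :=
    hS.computable.comp (computable_output Computable.snd happ hlen')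
  exact (hT.computablePred_leaves.comp Computable.snd).and
    (ComputablePred.exists_lt (h1.and (h2.and h3)) (Computable.succ.comp hlen))

/-- Minimality only inspects smaller codes, so a proposed block can be checked without deciding
whether an admissible block exists. -/
theorem computablePred_nextBlock (hT : IsComputableTreeOf T P) (hS : IsComputableTreeOf S Q) :
    ComputablePred fun x : List ℕ × List ℕ => NextBlock T S x.1 x.2 := by
  have h := computablePred_progress hT hS
  refine (hT.computablePred_leaves.comp Computable.snd).and
    ((computablePred_eq Computable.fst (Computable.const [])).or (h.and ?_))
  exact ComputablePred.forall_lt (h.comp ((Computable.fst.comp Computable.fst).pair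
    ((Computable.ofNat (List ℕ)).comp Computable.snd))).not (Computable.encode.comp Computable.snd)

theorem exists_nextBlock {σ ρ : List ℕ} (h : Progress T S σ ρ) : ∃ ρ', NextBlock T S σ ρ' := by
  classical
  have h' : ∃ m, Progress T S σ (ofNat (List ℕ) m) := ⟨encode ρ, by simpa using h⟩
  have h1 := Nat.find_spec h'
  exact ⟨_, h1.1, Or.inr ⟨h1, fun m hm => Nat.find_min h' (by simpa using hm)⟩⟩

/-- The sequence of the strings that result from adding one block after another is computable. -/
theorem computable_of_nextBlock (hT : IsComputableTreeOf T P) (hS : IsComputableTreeOf S Q)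
    {σ : ℕ → List ℕ} (hne : ∀ s, σ s ≠ [])
    (hσ : ∀ s, ∃ ρ, NextBlock T S (σ s) ρ ∧ σ (s + 1) = σ s ++ ρ) : Computable σ := by
  classical
  have hp : Computable₂ fun (τ : List ℕ) (m : ℕ) => decide (Progress T S τ (ofNat (List ℕ) m)) :=
    (computablePred_iff_decide.1 (computablePred_progress hT hS)).comp
      (Computable.fst.pair ((Computable.ofNat (List ℕ)).comp Computable.snd))
  -- After the first block the next one is unique, and unbounded search finds it.
  let next : List ℕ →. List ℕ := fun τ =>
    (Nat.rfind fun m => Part.some (decide (Progress T S τ (ofNat (List ℕ) m)))).map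
      fun m => τ ++ ofNat (List ℕ) m
  have hnext : Partrec next := (Partrec.rfind hp.partrec₂).map
    (Computable.list_append.comp Computable.fst
      ((Computable.ofNat (List ℕ)).comp Computable.snd)).to₂
  have h := Partrec.nat_rec (f := fun n : ℕ => n) (g := fun _ => Part.some (σ 0))
    (h := fun _ x => next x.2) Computable.id (Computable.const (σ 0)).partrec
    (hnext.comp (Computable.snd.comp Computable.snd)).to₂
  refine h.of_eq_tot fun n => ?_
  induction n with
  | zero => exact Part.mem_some _
  | succ n ih =>
    refine Part.mem_bind ih ?_
    obtain ⟨ρ, hρ, h1⟩ := hσ n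
    obtain ⟨h2, h3⟩ := hρ.2.resolve_left (hne n)
    rw [h1]
    refine (Part.mem_map_iff _).2 ⟨encode ρ, Nat.mem_rfind.2 ⟨?_, fun hm => ?_⟩, by simp⟩
    · simpa using h2
    · simpa using h3 _ hm

/-- The extension strategy terminates: otherwise it yields a computable path of `S`. -/
theorem not_forall_nextBlock (hT : IsComputableTreeOf T P) (hP : P.Nonempty)
    (hS : IsComputableTreeOf S Q) (hQ : ∀ f ∈ Q, ¬ Computable f) {σ : ℕ → List ℕ}
    (h0 : σ 0 ∈ leaves T) (hσ : ∀ s, ∃ ρ, NextBlock T S (σ s) ρ ∧ σ (s + 1) = σ s ++ ρ) :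
    False := by
  have hmono : ∀ m n, m ≤ n → σ m <+: σ n := by
    intro m n hmn
    induction hmn with
    | refl => exact List.prefix_refl _
    | step _ ih =>
      obtain ⟨ρ, -, hi⟩ := hσ _
      exact ih.trans (hi ▸ List.prefix_append _ _)
  have hlen : ∀ n, n < (σ n).length := by
    intro n
    induction n with
    | zero => exact List.length_pos_iff.2 (hT.ne_nil_of_mem_leaves hP h0)
    | succ n ih =>
      obtain ⟨ρ, hρ, hi⟩ := hσ n
      have := List.length_pos_iff.2 (hT.ne_nil_of_mem_leaves hP hρ.1)
      rw [hi, List.length_append]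
      omega
  have hne : ∀ n, σ n ≠ [] := fun n => List.length_pos_iff.1 ((Nat.zero_le n).trans_lt (hlen n))
  have hc := computable_of_nextBlock hT hS hne hσ
  -- Pigeonhole: every step makes progress through one of the finitely many `e ≤ |σ 0|`.
  obtain ⟨e, he⟩ : ∃ e, ∃ᶠ s in atTop,
      (∀ i < (σ s).length, (run e (σ (s + 1)) i).isSome = true) ∧
        output e (σ (s + 1)) (σ s).length ∈ S := by
    by_contra! H
    have := (eventually_all_finset (Finset.range ((σ 0).length + 1))).2 fun e _ => H e
    obtain ⟨s, hs⟩ := this.exists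
    obtain ⟨ρ, hρ, hi⟩ := hσ s
    obtain ⟨-, e, he1, he2, he3⟩ := (hρ.2.resolve_left (hne s)).1
    refine hs e ?_ (hi ▸ he3.1) (hi ▸ he3.2)
    rw [Finset.mem_range, Nat.lt_succ_iff]
    -- Since `σ 0` is a leaf, a prefix of `σ s` lying in `T` cannot be longer than `σ 0`; this is
    -- how `Progress` bounds `e`.
    rcases List.prefix_or_prefix_of_prefix (hmono 0 s (Nat.zero_le s)) (List.take_prefix e (σ s))
      with h1 | h1
    · rw [← h0.2 _ he2 h1, List.length_take]
      omega
    · simpa [Nat.lt_succ_iff.1 he1] using h1.length_le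
  have hrun : ∀ i, ∃ s v, run e (σ s) i = some v := by
    intro i
    obtain ⟨s, hs, h1, -⟩ := frequently_atTop.1 he i
    exact ⟨s + 1, Option.isSome_iff_exists.1 (h1 i (hs.trans_lt (hlen s)))⟩
  have hrm : ∀ {i v m n}, m ≤ n → v ∈ run e (σ m) i → v ∈ run e (σ n) i :=
    fun hmn h => run_mono (hmono _ _ hmn) h
  have hdom : ∀ i, (Nat.rfindOpt fun s => run e (σ s) i).Dom := fun i => Nat.rfindOpt_dom.2 (hrun i)
  let h : ℕ → ℕ := fun i => (Nat.rfindOpt fun s => run e (σ s) i).get (hdom i)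
  have hh : ∀ i, h i ∈ Nat.rfindOpt fun s => run e (σ s) i := fun i => Part.get_mem _
  have hcomp : Computable h := by
    have hr : Computable₂ fun i s => run e (σ s) i :=
      computable_run (Computable.const e) (hc.comp Computable.snd) Computable.fst
    exact (Partrec.rfindOpt hr).of_eq_tot hh
  have heq : ∀ {s i}, (run e (σ s) i).isSome = true → run e (σ s) i = some (h i) := by
    intro s i hs
    obtain ⟨v, hv⟩ := Option.isSome_iff_exists.1 hs
    rw [hv, Part.mem_unique ((Nat.rfindOpt_mono hrm).2 ⟨s, hv⟩) (hh i)]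
  refine hQ h ?_ hcomp
  rw [← hS.paths_eq]
  intro n
  obtain ⟨s, hs, h1, h2⟩ := frequently_atTop.1 he n
  rw [output_eq_restr fun i hi => heq (h1 i hi)] at h2
  exact hS.prefix_mem _ _ (restr_prefix h (hs.trans (hlen s).le)) h2

/-- Termination for block sequences. The invariant `A` serves two uses: sequences along a given
path, and arbitrary admissible sequences. -/
theorem not_forall_exists_nextBlock (hT : IsComputableTreeOf T P) (hP : P.Nonempty)
    (hS : IsComputableTreeOf S Q) (hQ : ∀ f ∈ Q, ¬ Computable f) {A : List (List ℕ) → Prop}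
    {ρ : List ℕ} (hρ : ρ ∈ leaves T) (hAρ : A [ρ]) :
    ¬ ∀ L, A L → [ρ] <+: L → ∃ τ, NextBlock T S L.flatten τ ∧ A (L ++ [τ]) := by
  intro H
  choose! next hnext using H
  let L : ℕ → List (List ℕ) := fun n => n.rec [ρ] fun _ L => L ++ [next L]
  have hL : ∀ n, A (L n) ∧ [ρ] <+: L n := by
    intro n
    induction n with
    | zero => exact ⟨hAρ, List.prefix_refl _⟩
    | succ n ih => exact ⟨(hnext _ ih.1 ih.2).2, ih.2.trans (List.prefix_append _ _)⟩
  refine not_forall_nextBlock hT hP hS hQ (σ := fun n => (L n).flatten) ?_ fun s =>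
    ⟨next (L s), (hnext _ (hL s).1 (hL s).2).1, List.flatten_concat⟩
  simpa [L] using hρ

/-- A path outside `lcmPower T` would split into infinitely many blocks, against termination. -/
theorem paths_blockTree_nextBlock_subset (hT : IsComputableTreeOf T P) (hP : P.Nonempty)
    (hS : IsComputableTreeOf S Q) (hQ : ∀ f ∈ Q, ¬ Computable f) :
    paths (blockTree T (NextBlock T S)) ⊆ lcmPower T := by
  have hR : ∀ σ τ, NextBlock T S σ τ → τ ∈ leaves T := fun _ _ h => h.1
  intro g hg
  by_contra H
  have hstep := fun {L} => exists_block_of_mem_paths_blockTree (L := L) (hT.nil_mem hP) hR hg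
    fun L hL f hf h => H (mem_lcmPower_iff.2 ⟨L, hL.forall_mem hR, f, hf, h⟩)
  obtain ⟨ρ, hρ, h1⟩ := hstep (IsBlockSeq.nil _) rfl
  refine not_forall_exists_nextBlock hT hP hS hQ
    (A := fun L => IsBlockSeq (NextBlock T S) L ∧ L.flatten = restr g L.flatten.length)
    hρ.1 ⟨isBlockSeq_concat.2 ⟨IsBlockSeq.nil _, hρ⟩, h1⟩ fun L hL _ => ?_
  obtain ⟨τ, hτ, h2⟩ := hstep hL.1 hL.2
  exact ⟨τ, hτ, isBlockSeq_concat.2 ⟨hL.1, hτ⟩, h2⟩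

theorem exists_path_forall_not_functionalEq (hT : IsComputableTreeOf T P) (hP : IsSpecial P)
    (hS : IsComputableTreeOf S Q) (hQ : ∀ f ∈ Q, ¬ Computable f) (b : ℕ) :
    ∃ g ∈ paths (blockTree T (NextBlock T S)), ∀ e < b, ∀ h ∈ Q, ¬ FunctionalEq e g h := by
  obtain ⟨f, hf⟩ := hP.1
  rw [← hT.paths_eq] at hf
  -- A first block of length at least `b` puts all `e < b` under consideration.
  obtain ⟨ρ, hρ, hfρ⟩ := hT.exists_leaf hP.2 (hf b)
  have hR : ∀ σ τ, NextBlock T S σ τ → τ ∈ leaves T := fun _ _ h => h.1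
  have hA := not_forall_exists_nextBlock hT hP.1 hS hQ (A := IsBlockSeq (NextBlock T S)) hρ
    (isBlockSeq_concat.2 ⟨IsBlockSeq.nil _, hρ, Or.inl rfl⟩)
  push Not at hA
  obtain ⟨L, hL, ⟨M, rfl⟩, hdead⟩ := hA
  set σ := ([ρ] ++ M).flatten with hσ
  refine ⟨prepend σ f, hT.prepend_mem_paths_blockTree hR hL hf, fun e he h hh H => ?_⟩
  obtain ⟨n, hn⟩ := H.exists_run σ.length
  -- The part of `f` used by the computation is absorbed into a leaf, which then makes progress
  -- after the dead end `σ`.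
  obtain ⟨τ, hτ, hfτ⟩ := hT.exists_leaf hP.2 (hf n)
  have hpre : restr (prepend σ f) n <+: σ ++ τ := by
    refine (restr_prefix _ (Nat.le_add_left n σ.length)).trans ?_
    rwa [restr_prepend_add, List.prefix_append_right_inj]
  have hrun : ∀ i < σ.length, run e (σ ++ τ) i = some (h i) := fun i hi => run_mono hpre (hn i hi)
  have hρσ : ρ <+: σ := by simp [hσ]
  have hbρ : b ≤ ρ.length := by simpa using hfρ.length_le
  have hprog : Progress T S σ τ := by
    refine ⟨hτ, e, by have := hρσ.length_le; omega, ?_, fun i hi => by simp [hrun i hi], ?_⟩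
    · refine hT.prefix_mem _ _ (List.prefix_of_prefix_length_le (List.take_prefix e σ) hρσ ?_) hρ.1
      rw [List.length_take]
      omega
    · rw [output_eq_restr hrun]
      rw [← hS.paths_eq] at hh
      exact hh _
  obtain ⟨τ', hτ'⟩ := exists_nextBlock hprog
  exact hdead τ' hτ' (isBlockSeq_concat.2 ⟨hL, hτ'⟩)

end

/-! ### Reducibilities -/

section

variable {A B C : Set (ℕ → ℕ)}

theorem Reducible.mono {𝓕 : ((ℕ → ℕ) →. (ℕ → ℕ)) → Prop} (h : Reducible 𝓕 A B) (hC : C ⊆ B) :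
    Reducible 𝓕 A C := by
  obtain ⟨Γ, h1, h2⟩ := h
  exact ⟨Γ, h1, fun g hg => h2 g (hC hg)⟩

theorem Reducible.exists_lt (h : Reducible FinOneComputable A B) :
    ∃ b, ∀ g ∈ B, ∃ e < b, ∃ h ∈ A, FunctionalEq e g h := by
  obtain ⟨Γ, ⟨b, hb⟩, h⟩ := h
  refine ⟨b, fun g hg => ?_⟩
  obtain ⟨k, hk, hA⟩ := h g hg
  obtain ⟨e, he, H⟩ := hb g k hk
  exact ⟨e, he, k, hA, H⟩

theorem reducible_finOne_of_exists_lt {b : ℕ}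
    (h : ∀ g ∈ B, ∃ e < b, ∃ h ∈ A, FunctionalEq e g h) : Reducible FinOneComputable A B := by
  choose! e he k hk H using h
  refine ⟨fun g => ⟨g ∈ B, fun _ => k g⟩, ⟨b, ?_⟩, fun g hg => ⟨k g, ⟨hg, rfl⟩, hk g hg⟩⟩
  rintro g _ ⟨hg, rfl⟩
  exact ⟨e g, he g hg, H g hg⟩

theorem reducible_oneOmega_of_eventually {Ψ : List ℕ → ℕ} (hΨ : Computable Ψ)
    (h : ∀ g ∈ B, ∃ e, (∀ᶠ n in atTop, Ψ (restr g n) = e) ∧ ∃ h ∈ A, FunctionalEq e g h) :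
    Reducible OneOmegaComputable A B := by
  choose! e he k hk H using h
  refine ⟨fun g => ⟨g ∈ B, fun _ => k g⟩, ⟨Ψ, hΨ, ?_⟩, fun g hg => ⟨k g, ⟨hg, rfl⟩, hk g hg⟩⟩
  rintro g _ ⟨hg, rfl⟩
  exact ⟨e g, he g hg, H g hg⟩

/-- The functionals that delete an initial segment of the oracle. -/
theorem exists_shift_functional : ∃ d : ℕ → ℕ, Computable d ∧
    ∀ p g, FunctionalEq (d p) g fun i => g (p + i) := by
  have hF : Computable fun x : ℕ × List ℕ × ℕ => x.2.1[x.1 + x.2.2]? :=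
    Computable.list_getElem?.comp (Computable.fst.comp Computable.snd)
      (Primrec.nat_add.to_comp.comp Computable.fst (Computable.snd.comp Computable.snd))
  obtain ⟨d, hd, h⟩ := exists_functional (F := fun p σ i => σ[p + i]?) hF
  refine ⟨d, hd, fun p g => h _ _ _ (fun n => ⟨p + n + 1, ?_⟩) fun n k w hw => ?_⟩
  · simp [restr]
  · simp only [restr, List.getElem?_map, Option.map_eq_some_iff] at hw
    obtain ⟨j, hj, rfl⟩ := hw
    obtain ⟨_, rfl⟩ := List.getElem?_eq_some_iff.1 hj
    simp

theorem exists_id_functional : ∃ e, ∀ g, FunctionalEq e g g := by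
  obtain ⟨d, -, h⟩ := exists_shift_functional
  exact ⟨d 0, fun g => by simpa using h 0 g⟩

theorem reducible_finOne_of_subset (h : B ⊆ A) : Reducible FinOneComputable A B := by
  obtain ⟨e, he⟩ := exists_id_functional
  exact reducible_finOne_of_exists_lt fun g hg => ⟨e, e.lt_succ_self, g, h hg, he g⟩

theorem reducible_oneOmega_of_subset (h : B ⊆ A) : Reducible OneOmegaComputable A B := by
  obtain ⟨e, he⟩ := exists_id_functional
  exact reducible_oneOmega_of_eventually (Computable.const e)
    fun g hg => ⟨e, Eventually.of_forall fun _ => rfl, g, h hg, he g⟩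

/-- The number of mind changes of a learner, up to the end of `σ`. -/
def mindChangeCount (Ψ : List ℕ → ℕ) (σ : List ℕ) : ℕ :=
  Nat.count (fun m => Ψ (σ.take (m + 1)) ≠ Ψ (σ.take m)) σ.length

theorem computable_mindChangeCount {Ψ : List ℕ → ℕ} (hΨ : Computable Ψ) :
    Computable (mindChangeCount Ψ) := by
  have htake : ∀ {f : List ℕ × ℕ × ℕ → ℕ}, Computable f →
      Computable fun x : List ℕ × ℕ × ℕ => Ψ (x.1.take (f x)) := fun hf =>
    hΨ.comp (Primrec.list_take.to_comp.comp hf Computable.fst)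
  have hm : Computable fun x : List ℕ × ℕ × ℕ => x.2.1 := Computable.fst.comp Computable.snd
  have hr : Computable fun x : List ℕ × ℕ × ℕ => x.2.2 := Computable.snd.comp Computable.snd
  have hdec : Computable fun x : List ℕ × ℕ × ℕ =>
      decide (Ψ (x.1.take (x.2.1 + 1)) ≠ Ψ (x.1.take x.2.1)) :=
    ComputablePred.decide
      (computablePred_eq (htake (Computable.succ.comp hm)) (htake hm)).not
  have hstep : Computable₂ fun (σ : List ℕ) (x : ℕ × ℕ) =>
      bif decide (Ψ (σ.take (x.1 + 1)) ≠ Ψ (σ.take x.1)) then x.2 + 1 else x.2 :=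
    Computable.cond hdec (Computable.succ.comp hr) hr
  refine (Computable.nat_rec (Computable.list_length (α := ℕ)) (Computable.const 0)
    hstep).of_eq fun σ => ?_
  rw [mindChangeCount]
  generalize σ.length = n
  induction n with
  | zero => simp
  | succ n ih =>
    rw [Nat.count_succ, ← ih]
    by_cases h : Ψ (σ.take (n + 1)) = Ψ (σ.take n) <;> simp [h]

/-- For each `i ≤ b` there is one functional: it trusts the learner's guess only while exactly `i`
mind changes have occurred. The true final count gives the right one. -/
theorem Reducible.finOne_of_oneFin (h : Reducible OneFinComputable A B) :
    Reducible FinOneComputable A B := by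
  classical
  obtain ⟨Γ, ⟨Ψ, hΨ, hid, b, hb⟩, hΓ⟩ := h
  set c := mindChangeCount Ψ with hcdef
  have hc : Computable c := computable_mindChangeCount hΨ
  have hcg : ∀ g n, c (restr g n) = Nat.count (· ∈ mindChanges Ψ g) n := by
    intro g n
    simp only [hcdef, mindChangeCount, length_restr, Nat.count_eq_card_filter_range]
    refine congrArg Finset.card (Finset.filter_congr fun m hm => ?_)
    rw [Finset.mem_range] at hm
    rw [take_restr, take_restr, min_eq_left hm.le, min_eq_left (Nat.succ_le_of_lt hm)]
    rfl
  have hF : Computable fun x : ℕ × List ℕ × ℕ =>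
      bif decide (c x.2.1 = x.1) then run (Ψ x.2.1) x.2.1 x.2.2 else none := by
    have hσ : Computable fun x : ℕ × List ℕ × ℕ => x.2.1 := Computable.fst.comp Computable.snd
    exact Computable.cond (ComputablePred.decide
      (computablePred_eq (hc.comp hσ) Computable.fst))
      (computable_run (hΨ.comp hσ) hσ (Computable.snd.comp Computable.snd))
      (Computable.const none)
  obtain ⟨d, -, hd⟩ := exists_functional
    (F := fun i σ n => bif decide (c σ = i) then run (Ψ σ) σ n else none) hF
  refine reducible_finOne_of_exists_lt (b := (Finset.range (b + 1)).sup d + 1) fun g hg => ?_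
  obtain ⟨h, hh, hA⟩ := hΓ g hg
  obtain ⟨e, he, H⟩ := hid g h hh
  have hbound : ∀ n, c (restr g n) ≤ b := by
    intro n
    rw [hcg, Nat.count_eq_card_filter_range]
    have h1 := hb g (Part.dom_iff_mem.2 ⟨h, hh⟩)
    have h2 : (((Finset.range n).filter (· ∈ mindChanges Ψ g) : Finset ℕ) : Set ℕ) ⊆
        mindChanges Ψ g := fun m hm => (Finset.mem_filter.1 hm).2
    have h3 := (Set.encard_le_encard h2).trans h1
    rw [Set.encard_coe_eq_coe_finsetCard] at h3
    exact_mod_cast h3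
  have hmono : Monotone fun n => c (restr g n) := by
    simp only [hcg]
    exact Nat.count_monotone _
  obtain ⟨N, hN⟩ : ∃ N, ∀ n, c (restr g n) ≤ c (restr g N) := by
    have hfin : (Set.range fun n => c (restr g n)).Finite :=
      (Set.finite_Iic b).subset (by rintro _ ⟨n, rfl⟩; exact hbound n)
    obtain ⟨_, ⟨N, rfl⟩, hN⟩ := hfin.exists_maximal (Set.range_nonempty _)
    exact ⟨N, fun n => (le_total _ _).elim id fun h => hN ⟨n, rfl⟩ h⟩
  -- Once the maximal count is reached no change can follow, so the current guess is the limit.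
  have hstable : ∀ n, c (restr g n) = c (restr g N) → Ψ (restr g n) = e := by
    intro n hn
    have h1 : ∀ m, n ≤ m → Ψ (restr g m) = Ψ (restr g n) := by
      intro m hm
      induction m, hm using Nat.le_induction with
      | base => rfl
      | succ m hm ih =>
        rw [← ih]
        by_contra hne
        have h2 := hcg g (m + 1)
        rw [Nat.count_succ, if_pos (show m ∈ mindChanges Ψ g from hne), ← hcg] at h2
        have h3 := hN (m + 1)
        have h4 : c (restr g n) ≤ c (restr g m) := hmono hm
        omega
    obtain ⟨m, hm, hnm⟩ := (he.and (eventually_ge_atTop n)).exists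
    rw [← h1 m hnm, hm]
  refine ⟨d (c (restr g N)), Nat.lt_succ_of_le (Finset.le_sup (f := d) (by
    simpa [Nat.lt_succ_iff] using hbound N)), h, hA, hd _ _ _ (fun n => ?_) fun n k w hw => ?_⟩
  · obtain ⟨k, hk, hNk⟩ := ((H.eventually_run n).and (eventually_ge_atTop N)).exists
    have hck := (hN k).antisymm (hmono hNk)
    exact ⟨k, by simp only [hck, decide_true, cond_true, hstable k hck, hk]⟩
  · by_cases hck : c (restr g k) = c (restr g N)
    · simp only [hck, decide_true, cond_true, hstable k hck] at hw
      exact H.eq_of_run hw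
    · simp [hck] at hw

end

/-! ### Learning the final path, and the intermediate set -/

section

variable {T : Set (List ℕ)} {P Q : Set (ℕ → ℕ)}

/-- The learner guesses the least split of its data into leaves followed by a node of `T`, and
deletes the leaves. Unique parsing makes the guess stabilize. -/
theorem reducible_oneOmega_lcmPower (hT : IsComputableTreeOf T P) (hP : P.Nonempty) :
    Reducible OneOmegaComputable P (lcmPower T) := by
  classical
  obtain ⟨d, hd, hshift⟩ := exists_shift_functional
  have hblock := computablePred_isBlockString (R := fun _ ρ => ρ ∈ leaves T)
    (fun _ _ h => hT.ne_nil_of_mem_leaves hP h) (hT.computablePred_leaves.comp Computable.snd)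
  -- The alternative `η.length ≤ p` only makes the search total on arbitrary data.
  have hex : ∀ η : List ℕ, ∃ p, η.length ≤ p ∨
      IsBlockString (fun _ ρ => ρ ∈ leaves T) (η.take p) ∧ η.drop p ∈ T :=
    fun η => ⟨_, Or.inl le_rfl⟩
  have hfind := Computable.find (P := fun (η : List ℕ) p => η.length ≤ p ∨
      IsBlockString (fun _ ρ => ρ ∈ leaves T) (η.take p) ∧ η.drop p ∈ T)
    ((computablePred_le (Computable.list_length.comp Computable.fst) Computable.snd).or
      ((hblock.comp (Primrec.list_take.to_comp.comp Computable.snd Computable.fst)).and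
        (hT.computable.comp (Primrec.list_drop.to_comp.comp Computable.snd Computable.fst)))) hex
  refine reducible_oneOmega_of_eventually (hd.comp hfind) fun g hg => ?_
  obtain ⟨L, hL, f, hf, rfl⟩ := mem_lcmPower_iff.1 hg
  refine ⟨d L.flatten.length, ?_, f, by rwa [← hT.paths_eq], ?_⟩
  -- One entry past the blocks is needed: before that, the last leaf could itself be read as the
  -- final node.
  · refine eventually_atTop.2 ⟨L.flatten.length + 1, fun n hn => ?_⟩
    obtain ⟨k, rfl⟩ := Nat.exists_eq_add_of_le hn
    have hη : restr (prepend L.flatten f) (L.flatten.length + 1 + k) =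
        L.flatten ++ restr f (1 + k) := by rw [add_assoc, restr_prepend_add]
    refine congrArg d ((Nat.find_eq_iff _).2 ⟨Or.inr ⟨⟨L, isBlockSeq_of_forall_mem hL, ?_⟩, ?_⟩, ?_⟩)
    · rw [hη, List.take_left]
    · rw [hη, List.drop_left]
      exact hf _
    · rintro p hp (h | ⟨⟨L', hL', h1⟩, h2⟩)
      · rw [length_restr] at h
        omega
      · have hp' : p < (restr (prepend L.flatten f) (L.flatten.length + 1 + k)).length := by
          rw [length_restr]
          omega
        have := eq_of_flatten_append_eq hL (hL'.forall_mem fun _ _ h => h) (hf (1 + k)) h2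
          (List.length_pos_iff.1 (by rw [length_restr]; omega))
          (List.length_pos_iff.1 (by rw [List.length_drop]; omega))
          (by rw [h1, List.take_append_drop, hη])
        subst this
        have := congrArg List.length h1
        rw [List.length_take] at this
        omega
  · convert hshift L.flatten.length (prepend L.flatten f) using 1
    funext i
    simp [prepend]

/-- A `Π⁰₁` set between `P` and the LCM disjunction of `P, P, …` to which `Q` is not reducible. -/
theorem exists_between (hT : IsComputableTreeOf T P) (hP : P.Nonempty) (hQ : IsPi01 Q)
    (hQs : IsSpecial Q) : ∃ P', IsPi01 P' ∧ P ⊆ P' ∧ P' ⊆ lcmPower T ∧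
      ¬ Reducible FinOneComputable Q P' := by
  obtain ⟨S, hS⟩ := hQ
  -- Leaves above every node are only guaranteed when `P` has no computable member. A computable
  -- member is instead mapped only to computable functions, none of which is in `Q`.
  by_cases hcomp : ∃ f ∈ P, Computable f
  · obtain ⟨f, hf, hfc⟩ := hcomp
    refine ⟨P, ⟨T, hT⟩, subset_rfl, fun g hg => mem_lcmPower_iff.2
      ⟨[], by simp, g, by rwa [hT.paths_eq], by simp⟩, fun h => ?_⟩
    obtain ⟨b, hb⟩ := h.exists_lt
    obtain ⟨e, -, h, hh, H⟩ := hb f hf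
    exact hQs.2 h hh (H.computable hfc)
  · push Not at hcomp
    have hR : ∀ σ τ, NextBlock T S σ τ → τ ∈ leaves T := fun _ _ h => h.1
    refine ⟨paths (blockTree T (NextBlock T S)),
      ⟨_, hT.blockTree hP hR (computablePred_nextBlock hT hS)⟩, fun g hg => ?_,
      paths_blockTree_nextBlock_subset hT hP hS hQs.2, fun h => ?_⟩
    · rw [← hT.paths_eq] at hg
      simpa using hT.prepend_mem_paths_blockTree hR (IsBlockSeq.nil _) hg
    · obtain ⟨b, hb⟩ := h.exists_lt
      obtain ⟨g, hg, hno⟩ := exists_path_forall_not_functionalEq hT ⟨hP, hcomp⟩ hS hQs.2 b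
      obtain ⟨e, he, h, hh, H⟩ := hb g hg
      exact hno e he h hh H

end

end MassProblem

open MassProblem
theorem mainTheorem4 :
    (∀ (P Q : Set (ℕ → ℕ)) (T : Set (List ℕ)),
      IsComputableTreeOf T P → P.Nonempty → IsPi01 Q → IsSpecial Q →
        ∃ P' : Set (ℕ → ℕ), IsPi01 P' ∧ P' ⊆ lcmPower T ∧
          ¬ Reducible OneFinComputable Q P' ∧ ¬ Reducible FinOneComputable Q P') ∧
    (∀ (P : Set (ℕ → ℕ)) (T : Set (List ℕ)), IsComputableTreeOf T P → IsSpecial P →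
        StrictlyReducible FinOneComputable (lcmPower T) P ∧
          Equivalent OneOmegaComputable P (lcmPower T)) ∧
    (∀ P : Set (ℕ → ℕ), IsPi01 P → IsSpecial P →
        ∃ Q : Set (ℕ → ℕ), IsPi01 Q ∧ StrictlyReducible FinOneComputable Q P ∧
          Equivalent OneOmegaComputable P Q) := by
  refine ⟨fun P Q T hT hP hQ hQs => ?_, fun P T hT hP => ?_, fun P hP hPs => ?_⟩
  · obtain ⟨P', h1, -, h2, h3⟩ := exists_between hT hP hQ hQs
    exact ⟨P', h1, h2, fun h => h3 h.finOne_of_oneFin, h3⟩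
  -- Taking `Q = P`: a map of the whole disjunction into `P` would restrict to `P'`.
  · obtain ⟨P', -, h1, h2, h3⟩ := exists_between hT hP.1 ⟨T, hT⟩ hP
    exact ⟨⟨reducible_finOne_of_subset (h1.trans h2), fun h => h3 (h.mono h2)⟩,
      reducible_oneOmega_lcmPower hT hP.1, reducible_oneOmega_of_subset (h1.trans h2)⟩
  · obtain ⟨T, hT⟩ := hP
    obtain ⟨P', h0, h1, h2, h3⟩ := exists_between hT hPs.1 ⟨T, hT⟩ hPs
    exact ⟨P', h0, ⟨reducible_finOne_of_subset h1, h3⟩,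
      (reducible_oneOmega_lcmPower hT hPs.1).mono h2, reducible_oneOmega_of_subset h1⟩
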